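/- Let $G=(V,E)$ be a simple, undirected, connected graph (finite or infinite) that is $d$-regular with $d<\infty$, with combinatorial distance $d(\cdot,\cdot)$, spheres $S_k(x)=\{z: d(x,z)=k\}$ and ball $B_1(x)=\{z: d(x,z)\le 1\}$. For $p\in[0,1]$ and a vertex $x$ let $\mu_x^p$ be the probability distribution on $V$ with $\mu_x^p(x)=p$, $\mu_x^p(z)=\frac{1-p}{d}$ for $z\sim x$, and $\mu_x^p(z)=0$ otherwise. For an edge $\{x,y\}$ put $$\kappa_p(x,y)=1-W_1(\mu_x^p,\mu_y^p),\qquad \kappa_{LLY}(x,y)=\lim_{p\to 1,\ p<1}\frac{\kappa_p(x,y)}{1-p},$$ where $W_1(\mu,\nu)=\inf_\pi\sum_{u,v\in V}d(u,v)\,\pi(u,v)$, the infimum being over all $\pi:V\times V\to[0,\infty)$ with $\sum_v\pi(u,v)=\mu(u)$ and $\sum_u\pi(u,v)=\nu(v)$ for all $u, v$. Consider maps $\eta_1,\dots,\eta_d:B_1(x)\to V$ such that (i) $\eta_i(u)\sim u$ for all $u\in B_1(x)$ and all $i$; (ii) $\eta_i(u)\ne\eta_j(u)$ for all $u\in B_1(x)$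 and $i\neq j$; (iii) $\bigcup_j\{\eta_j(\eta_i(x))\}=\bigcup_j\{\eta_i(\eta_j(x))\}$ for all $i$. The vertex $x$ is called $(S)$-Ricci flat if there are such maps with, in addition, (S) $\eta_j(\eta_i(x))=\eta_i(\eta_j(x))$ for all $i,j$; it is called $(RS)$-Ricci flat if there are such maps satisfying both (S) and (R) $\eta_i(\eta_i(x))=x$ for all $i$. **Theorem.** Let $x\in V$ be a vertex that is not contained in a triangle and such that every $z\in S_2(x)$ has at most two neighbours in $S_1(x)$. Then: (a) $\kappa_0(x,y)=0$ for all $y\in S_1(x)$ if and only if $x$ is $(S)$-Ricci flat. (b) $\kappa_{LLY}(x,y)=\frac{2}{d}$ for all $y\in S_1(x)$ if and only if $x$ is $(RS)$-Ricci flat. -/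

import Mathlib

open Filter Topology

namespace RicciCurvature

variable {V : Type*}

/-- The combinatorial sphere `S_k(x)`. -/
def sphere (G : SimpleGraph V) (k : ℕ) (x : V) : Set V :=
  {z | G.dist x z = k}

/-- The combinatorial ball `B_k(x)`. -/
def ball (G : SimpleGraph V) (k : ℕ) (x : V) : Set V :=
  {z | G.dist x z ≤ k}

/-- `x` is contained in a triangle of `G`. -/
def InTriangle (G : SimpleGraph V) (x : V) : Prop :=
  ∃ y z : V, G.Adj x y ∧ G.Adj y z ∧ G.Adj z x

/-- The in-degree `d_x^-(z)`: the number of neighbours of `z` that are closer to `x` by one. -/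
noncomputable def inDegree (G : SimpleGraph V) (x z : V) : ℕ :=
  Set.ncard {y | G.Adj z y ∧ G.dist x y + 1 = G.dist x z}

open Classical in
/-- The probability distribution `μ_x^p` with idleness `p`. -/
noncomputable def idleMeasure (G : SimpleGraph V) [G.LocallyFinite] (p : ℝ) (x z : V) : ℝ :=
  if z = x then p else if G.Adj x z then (1 - p) / (G.degree x : ℝ) else 0

/-- `π` is a transport plan from `μ` to `ν`: a nonnegative function on `V × V` with
marginals `μ` and `ν`. -/
structure IsTransportPlan (μ ν : V → ℝ) (π : V → V → ℝ) : Prop where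
  nonneg : ∀ u v, 0 ≤ π u v
  fst_marginal : ∀ u, HasSum (fun v => π u v) (μ u)
  snd_marginal : ∀ v, HasSum (fun u => π u v) (ν v)

/-- `c` is the (finite) cost of the plan `π`, that is `c = ∑ d(u,v) π(u,v)`. -/
def HasCost (G : SimpleGraph V) (π : V → V → ℝ) (c : ℝ) : Prop :=
  HasSum (fun w : V × V => (G.dist w.1 w.2 : ℝ) * π w.1 w.2) c

/-- The Wasserstein distance `W_1(μ, ν)`, the infimum of the costs of all transport plans
(plans of infinite cost do not contribute to the infimum; between finitely supported
probability distributions on a connected graph every plan has finite cost). -/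
noncomputable def wasserstein (G : SimpleGraph V) (μ ν : V → ℝ) : ℝ :=
  sInf {c : ℝ | ∃ π : V → V → ℝ, IsTransportPlan μ ν π ∧ HasCost G π c}

/-- The Ollivier Ricci curvature `κ_p(x, y)` with idleness `p`. -/
noncomputable def kappa (G : SimpleGraph V) [G.LocallyFinite] (p : ℝ) (x y : V) : ℝ :=
  1 - wasserstein G (idleMeasure G p x) (idleMeasure G p y)

/-- `κ_LLY(x, y) = k`: the limit of `κ_p(x, y) / (1 - p)` as `p → 1`, `p < 1`, exists and
equals `k`. -/
def KappaLLYEq (G : SimpleGraph V) [G.LocallyFinite] (x y : V) (k : ℝ) : Prop :=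
  Tendsto (fun p : ℝ => kappa G p x y / (1 - p)) (𝓝[<] (1 : ℝ)) (𝓝 k)

/-- The maps `η_1, …, η_d` satisfy the conditions (i), (ii), (iii) of Ricci flatness at `x`.
The maps are represented by total functions; only their values on `B_1(x)` matter, since
`η_i x` lies in `B_1(x)` by the first condition. -/
structure IsRicciFlatFamily (G : SimpleGraph V) (d : ℕ) (x : V) (η : Fin d → V → V) :
    Prop where
  adj : ∀ i, ∀ u ∈ ball G 1 x, G.Adj (η i u) u
  ne : ∀ i j, i ≠ j → ∀ u ∈ ball G 1 x, η i u ≠ η j u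
  union_eq : ∀ i, (⋃ j, {η j (η i x)}) = ⋃ j, {η i (η j x)}

/-- Property (R), reflexivity. -/
def FamilyReflexive {d : ℕ} (x : V) (η : Fin d → V → V) : Prop :=
  ∀ i, η i (η i x) = x

/-- Property (S), symmetry. -/
def FamilySymmetric {d : ℕ} (x : V) (η : Fin d → V → V) : Prop :=
  ∀ i j, η j (η i x) = η i (η j x)

/-- The vertex `x` of the `d`-regular graph `G` is (S)-Ricci flat. -/
def IsSRicciFlat (G : SimpleGraph V) (d : ℕ) (x : V) : Prop :=
  ∃ η : Fin d → V → V, IsRicciFlatFamily G d x η ∧ FamilySymmetric x η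

/-- The vertex `x` of the `d`-regular graph `G` is (RS)-Ricci flat. -/
def IsRSRicciFlat (G : SimpleGraph V) (d : ℕ) (x : V) : Prop :=
  ∃ η : Fin d → V → V, IsRicciFlatFamily G d x η ∧ FamilyReflexive x η ∧ FamilySymmetric x η

end RicciCurvature

namespace RicciCurvature

/-! Both curvature conditions reduce to common neighbours in `S_2(x)`. Explicit potentials bound the
curvatures above by `0` and `2/d` (`kappa_zero_le_zero`, `kappa_le`). If two neighbours of `x` share
no neighbour with `y` except possibly `x`, then `κ_0 < 0` (`kappa_zero_neg`); if one neighbour other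
than `y` does so, then `κ_LLY` cannot exceed `1/d` (`kappa_le_of_no_common_neighbor`).

Conversely, choose for each pair in `S_1(x)` a common neighbour, symmetrically in the pair and
different from `x` where possible. Since a point of `S_2(x)` has at most two neighbours in `S_1(x)`,
different pairs with a common member get different points, so the choices form a family with (S)
(`exists_symmetric_family`). Its diagonal values are any unused neighbours in (a), and `x` itself in
(b).

A family with (S) matches the neighbourhoods of `x` and `y` along edges, and (R) makes this matching
send `y` to `x`; the resulting transport plans attain the upper bounds. -/

lemma mem_sphere_one_iff (G : SimpleGraph V) {x y : V} : y ∈ sphere G 1 x ↔ G.Adj x y :=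
  SimpleGraph.dist_eq_one_iff_adj

lemma mem_ball_one_iff {G : SimpleGraph V} (hG : G.Connected) {x y : V} :
    y ∈ ball G 1 x ↔ y = x ∨ G.Adj x y := by
  constructor
  · intro h
    have h' : G.dist x y ≤ 1 := h
    interval_cases hxy : G.dist x y
    · exact Or.inl ((hG.dist_eq_zero_iff).1 hxy).symm
    · exact Or.inr (SimpleGraph.dist_eq_one_iff_adj.1 hxy)
  · rintro (rfl | h)
    · simp [ball]
    · exact (SimpleGraph.dist_eq_one_iff_adj.2 h).le

lemma one_le_dist {G : SimpleGraph V} (hG : G.Connected) {u v : V} (h : u ≠ v) :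
    1 ≤ G.dist u v :=
  hG.pos_dist_of_ne h

lemma two_le_dist {G : SimpleGraph V} (hG : G.Connected) {u v : V} (h : u ≠ v)
    (h' : ¬ G.Adj u v) : 2 ≤ G.dist u v := by
  have h1 := one_le_dist hG h
  have h2 : G.dist u v ≠ 1 := fun h2 => h' (SimpleGraph.dist_eq_one_iff_adj.1 h2)
  omega

lemma not_adj_of_adj {G : SimpleGraph V} {x : V} (hx : ¬ InTriangle G x) {y z : V} (hy : G.Adj x y)
    (hz : G.Adj x z) : ¬ G.Adj y z :=
  fun h => hx ⟨y, z, hy, h, hz.symm⟩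

lemma IsRicciFlatFamily.injective {G : SimpleGraph V} {d : ℕ} {x u : V} {η : Fin d → V → V}
    (hη : IsRicciFlatFamily G d x η) (hu : u ∈ ball G 1 x) : Function.Injective fun i => η i u :=
  fun i j hij => by
    by_contra h
    exact hη.ne i j h u hu hij

/-! ### Transport plans and weak duality -/

section Plans

open Classical in
/-- Finitely many atoms `w i`, moved from `a i` to `b i`, form a transport plan. -/
lemma exists_plan_of_atoms (G : SimpleGraph V) {ι : Type*} [Fintype ι] (w : ι → ℝ)
    (hw : ∀ i, 0 ≤ w i) (a b : ι → V) {μ ν : V → ℝ}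
    (hμ : ∀ u, μ u = ∑ i, if u = a i then w i else 0)
    (hν : ∀ v, ν v = ∑ i, if v = b i then w i else 0) :
    ∃ π, IsTransportPlan μ ν π ∧ HasCost G π (∑ i, (G.dist (a i) (b i) : ℝ) * w i) := by
  refine ⟨fun u v => ∑ i, if u = a i ∧ v = b i then w i else 0, ⟨?_, ?_, ?_⟩, ?_⟩
  · intro u v
    refine Finset.sum_nonneg fun i _ => ?_
    split_ifs
    exacts [hw i, le_rfl]
  · intro u
    rw [hμ u]
    refine hasSum_sum fun i _ => ?_
    convert hasSum_single (b i) (f := fun v => if u = a i ∧ v = b i then w i else 0) ?_ using 1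
    · simp
    · intro v hv
      simp [hv]
  · intro v
    rw [hν v]
    refine hasSum_sum fun i _ => ?_
    convert hasSum_single (a i) (f := fun u => if u = a i ∧ v = b i then w i else 0) ?_ using 1
    · simp
    · intro u hu
      simp [hu]
  · unfold HasCost
    simp only [Finset.mul_sum]
    refine hasSum_sum fun i _ => ?_
    convert hasSum_single (a i, b i) (f := fun z : V × V =>
      (G.dist z.1 z.2 : ℝ) * if z.1 = a i ∧ z.2 = b i then w i else 0) ?_ using 1
    · simp
    · rintro ⟨u, v⟩ huv
      have : ¬ (u = a i ∧ v = b i) := fun h => huv (Prod.ext h.1 h.2)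
      simp [this]

lemma wasserstein_le {G : SimpleGraph V} {μ ν : V → ℝ} {π : V → V → ℝ} {c : ℝ}
    (hπ : IsTransportPlan μ ν π) (hc : HasCost G π c) : wasserstein G μ ν ≤ c := by
  refine csInf_le ⟨0, ?_⟩ ⟨π, hπ, hc⟩
  rintro c' ⟨π', hπ', hc'⟩
  exact hc'.nonneg fun z => mul_nonneg (Nat.cast_nonneg _) (hπ'.nonneg _ _)

/-- Weak Kantorovich duality for finitely supported measures. -/
lemma sum_sub_sum_le_cost (G : SimpleGraph V) {μ ν : V → ℝ} {π : V → V → ℝ} {c : ℝ}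
    (hπ : IsTransportPlan μ ν π) (hc : HasCost G π c) (s t : Finset V)
    (hs : ∀ u ∉ s, μ u = 0) (ht : ∀ v ∉ t, ν v = 0) (f : V → ℝ)
    (hf : ∀ u ∈ s, ∀ v ∈ t, f u - f v ≤ G.dist u v) :
    ∑ u ∈ s, f u * μ u - ∑ v ∈ t, f v * ν v ≤ c := by
  -- A nonnegative row or column with sum zero vanishes, so `π` lives on `s ×ˢ t` and all sums
  -- become finite.
  have h1 : ∀ u ∉ s, ∀ v, π u v = 0 := by
    intro u hu v
    have := hπ.fst_marginal u
    rw [hs u hu, hasSum_zero_iff_of_nonneg (hπ.nonneg u)] at this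
    exact congrFun this v
  have h2 : ∀ v ∉ t, ∀ u, π u v = 0 := by
    intro v hv u
    have := hπ.snd_marginal v
    rw [ht v hv, hasSum_zero_iff_of_nonneg (fun u => hπ.nonneg u v)] at this
    exact congrFun this u
  have hμ : ∀ u, μ u = ∑ v ∈ t, π u v := fun u =>
    (hπ.fst_marginal u).unique (hasSum_sum_of_ne_finset_zero fun v hv => h2 v hv u)
  have hν : ∀ v, ν v = ∑ u ∈ s, π u v := fun v =>
    (hπ.snd_marginal v).unique (hasSum_sum_of_ne_finset_zero fun u hu => h1 u hu v)
  have hcost : c = ∑ z ∈ s ×ˢ t, (G.dist z.1 z.2 : ℝ) * π z.1 z.2 := by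
    refine HasSum.unique hc (hasSum_sum_of_ne_finset_zero ?_)
    rintro ⟨u, v⟩ hz
    rw [Finset.mem_product, not_and_or] at hz
    rcases hz with hz | hz
    · simp [h1 u hz]
    · simp [h2 v hz]
  rw [hcost, Finset.sum_product]
  simp only [hμ, hν, Finset.mul_sum]
  rw [Finset.sum_comm (s := t), ← Finset.sum_sub_distrib]
  refine Finset.sum_le_sum fun u hu => ?_
  rw [← Finset.sum_sub_distrib]
  refine Finset.sum_le_sum fun v hv => ?_
  rw [← sub_mul]
  exact mul_le_mul_of_nonneg_right (hf u hu v hv) (hπ.nonneg u v)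

end Plans

/-! ### Plans and potentials for the idle measures -/

section IdleMeasure

variable {G : SimpleGraph V} [G.LocallyFinite] {d : ℕ}

lemma exists_eq_of_adj (hd : G.IsRegularOfDegree d) {x : V} {e : Fin d → V}
    (he : Function.Injective e) (hadj : ∀ i, G.Adj x (e i)) {u : V} (hu : G.Adj x u) :
    ∃ i, u = e i := by
  classical
  have h : Finset.univ.image e = G.neighborFinset x := by
    refine Finset.eq_of_subset_of_card_le ?_ ?_
    · intro v hv
      obtain ⟨i, -, rfl⟩ := Finset.mem_image.1 hv
      simpa using hadj i
    · rw [Finset.card_image_of_injective _ he, G.card_neighborFinset_eq_degree, hd x]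
      simp
  have hu' : u ∈ Finset.univ.image e := by rw [h]; simpa using hu
  obtain ⟨i, -, rfl⟩ := Finset.mem_image.1 hu'
  exact ⟨i, rfl⟩

lemma exists_enumeration (hd : G.IsRegularOfDegree d) (x : V) :
    ∃ e : Fin d → V, Function.Injective e ∧ ∀ i, G.Adj x (e i) := by
  have hcard : (G.neighborFinset x).card = d := by
    rw [G.card_neighborFinset_eq_degree, hd x]
  let E := (G.neighborFinset x).equivFinOfCardEq hcard
  refine ⟨fun i => (E.symm i : V), fun i j hij => E.symm.injective (Subtype.ext hij), fun i => ?_⟩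
  exact (G.mem_neighborFinset x _).1 (E.symm i).2

open Classical in
lemma idleMeasure_eq_sum (hd : G.IsRegularOfDegree d) (p : ℝ) {x : V} {e : Fin d → V}
    (he : Function.Injective e) (hadj : ∀ i, G.Adj x (e i)) (u : V) :
    idleMeasure G p x u
      = (if u = x then p else 0) + ∑ i, if u = e i then (1 - p) / (d : ℝ) else 0 := by
  unfold idleMeasure
  rw [hd x]
  by_cases hux : u = x
  · have : ∀ i, u ≠ e i := fun i h => (hadj i).ne (hux.symm.trans h)
    simp [hux] at this ⊢
    simp [this]
  · by_cases hu : G.Adj x u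
    · obtain ⟨i, rfl⟩ := exists_eq_of_adj hd he hadj hu
      simp [hux, hu, he.eq_iff]
    · have : ∀ i, u ≠ e i := fun i h => hu (h ▸ hadj i)
      simp [hux, hu, this]

lemma exists_plan_matching (hd : G.IsRegularOfDegree d) {p : ℝ} (h0 : 0 ≤ p) (h1 : p ≤ 1)
    {x y : V} {e e' : Fin d → V} (he : Function.Injective e) (hadj : ∀ i, G.Adj x (e i))
    (he' : Function.Injective e') (hadj' : ∀ i, G.Adj y (e' i)) :
    ∃ π, IsTransportPlan (idleMeasure G p x) (idleMeasure G p y) π ∧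
      HasCost G π (G.dist x y * p + ∑ i, (G.dist (e i) (e' i) : ℝ) * ((1 - p) / d)) := by
  classical
  have hw : 0 ≤ (1 - p) / (d : ℝ) := div_nonneg (by linarith) (Nat.cast_nonneg _)
  obtain ⟨π, hπ, hc⟩ := exists_plan_of_atoms G (ι := Option (Fin d))
    (fun o => o.elim p fun _ => (1 - p) / d) (by rintro (_ | i); exacts [h0, hw])
    (fun o => o.elim x e) (fun o => o.elim y e')
    (μ := idleMeasure G p x) (ν := idleMeasure G p y)
    (fun u => by rw [idleMeasure_eq_sum hd p he hadj, Fintype.sum_option]; rfl)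
    (fun u => by rw [idleMeasure_eq_sum hd p he' hadj', Fintype.sum_option]; rfl)
  refine ⟨π, hπ, ?_⟩
  rw [Fintype.sum_option] at hc
  exact hc

/-- A matching of the two neighbourhoods which sends `y` to `x` can be improved by leaving the
common mass at `x` and `y` where it is. -/
lemma exists_plan_of_swap (hd : G.IsRegularOfDegree d) {p : ℝ} (h1 : p ≤ 1)
    (hp : (1 - p) / d ≤ p) {x y : V} {e e' : Fin d → V} (he : Function.Injective e)
    (hadj : ∀ i, G.Adj x (e i)) (he' : Function.Injective e') (hadj' : ∀ i, G.Adj y (e' i))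
    {k : Fin d} (hk : e k = y) (hk' : e' k = x) (hedge : ∀ i, G.Adj (e i) (e' i)) :
    ∃ π, IsTransportPlan (idleMeasure G p x) (idleMeasure G p y) π ∧
      HasCost G π (1 - 2 * ((1 - p) / d)) := by
  classical
  have hd0 : (d : ℝ) ≠ 0 := by
    have := k.pos
    positivity
  set w : ℝ := (1 - p) / d with hwdef
  have hw : 0 ≤ w := div_nonneg (by linarith) (Nat.cast_nonneg _)
  have hxy : G.dist x y = 1 := SimpleGraph.dist_eq_one_iff_adj.2 (hk ▸ hadj k)
  -- Mass `p - w` moves from `x` to `y`, mass `w` stays at `x`, and redirecting the atom `k` to `y`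
  -- makes it stay there. The cost is `p - w + (d - 1) w = 1 - 2w`.
  obtain ⟨π, hπ, hc⟩ := exists_plan_of_atoms G (ι := Option (Option (Fin d)))
    (fun o => o.elim (p - w) fun _ => w)
    (by rintro (_ | i); exacts [sub_nonneg.2 hp, hw])
    (fun o => o.elim x fun o => o.elim x e)
    (fun o => o.elim y fun o => o.elim x (Function.update e' k y))
    (μ := idleMeasure G p x) (ν := idleMeasure G p y)
    (fun u => by
      rw [idleMeasure_eq_sum hd p he hadj, Fintype.sum_option, Fintype.sum_option]
      change _ = (if u = x then p - w else 0) + ((if u = x then w else 0) +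
        ∑ i, if u = e i then w else 0)
      split_ifs <;> ring)
    (fun u => by
      rw [idleMeasure_eq_sum hd p he' hadj', Fintype.sum_option, Fintype.sum_option]
      change _ = (if u = y then p - w else 0) + ((if u = x then w else 0) +
        ∑ i, if u = Function.update e' k y i then w else 0)
      rw [← Finset.add_sum_erase _ _ (Finset.mem_univ k),
        ← Finset.add_sum_erase (a := k) (f := fun i => if u = Function.update e' k y i then w
          else 0) _ (Finset.mem_univ k)]
      have : ∑ i ∈ Finset.univ.erase k, (if u = Function.update e' k y i then w else 0)
          = ∑ i ∈ Finset.univ.erase k, (if u = e' i then w else 0) :=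
        Finset.sum_congr rfl fun i hi => by
          rw [Function.update_of_ne (Finset.ne_of_mem_erase hi)]
      rw [this, Function.update_self, hk']
      split_ifs <;> ring)
  refine ⟨π, hπ, ?_⟩
  convert hc using 1
  rw [Fintype.sum_option, Fintype.sum_option]
  simp only [Option.elim]
  rw [← Finset.add_sum_erase _ _ (Finset.mem_univ k)]
  have : ∑ i ∈ Finset.univ.erase k, (G.dist (e i) (Function.update e' k y i) : ℝ) * w
      = ∑ i ∈ Finset.univ.erase k, w :=
    Finset.sum_congr rfl fun i hi => by
      rw [Function.update_of_ne (Finset.ne_of_mem_erase hi),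
        SimpleGraph.dist_eq_one_iff_adj.2 (hedge i)]
      simp
  rw [this, Function.update_self, hk, hxy, Finset.sum_const, Finset.card_erase_of_mem
    (Finset.mem_univ k), Finset.card_univ, Fintype.card_fin, nsmul_eq_mul, Nat.cast_sub k.pos]
  simp only [SimpleGraph.dist_self]
  have : (d : ℝ) * w = 1 - p := by rw [hwdef]; field_simp
  push_cast
  linear_combination -this

open Classical in
lemma sum_mul_idleMeasure (hd : G.IsRegularOfDegree d) (p : ℝ) (x : V) (f : V → ℝ) :
    ∑ u ∈ insert x (G.neighborFinset x), f u * idleMeasure G p x u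
      = p * f x + (1 - p) / d * ∑ u ∈ G.neighborFinset x, f u := by
  rw [Finset.sum_insert (by simp), Finset.mul_sum]
  congr 1
  · simp [idleMeasure, mul_comm]
  · refine Finset.sum_congr rfl fun u hu => ?_
    have hu' : G.Adj x u := by simpa using hu
    simp [idleMeasure, hu', hu'.ne', hd x, mul_comm]

open Classical in
/-- Lower bound for the Wasserstein distance by a potential with values in `{0, 1, 2}`. -/
lemma le_wasserstein (hG : G.Connected) (hd : G.IsRegularOfDegree d) {p : ℝ} (h0 : 0 ≤ p)
    (h1 : p ≤ 1) (x y : V) (S A : Set V) (hAS : A ⊆ S)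
    (hA : ∀ u ∈ A, ∀ v, (v = y ∨ G.Adj y v) → v ∉ S → ¬ G.Adj u v) :
    p * ((S.indicator 1 x + A.indicator 1 x) - (S.indicator 1 y + A.indicator 1 y))
      + (1 - p) / d * (∑ u ∈ G.neighborFinset x, (S.indicator 1 u + A.indicator 1 u)
        - ∑ u ∈ G.neighborFinset y, (S.indicator 1 u + A.indicator 1 u))
      ≤ wasserstein G (idleMeasure G p x) (idleMeasure G p y) := by
  -- Some plan must exist, since the real infimum of the empty set would be `0`.
  obtain ⟨e, he, hadj⟩ := exists_enumeration hd x
  obtain ⟨e', he', hadj'⟩ := exists_enumeration hd y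
  obtain ⟨π, hπ, hc⟩ := exists_plan_matching hd h0 h1 he hadj he' hadj'
  refine le_csInf ⟨_, π, hπ, hc⟩ ?_
  rintro c ⟨π', hπ', hc'⟩
  have hsupp : ∀ x, ∀ u ∉ insert x (G.neighborFinset x), idleMeasure G p x u = 0 := by
    intro x u hu
    simp only [Finset.mem_insert, SimpleGraph.mem_neighborFinset, not_or] at hu
    simp [idleMeasure, hu.1, hu.2]
  have key := sum_sub_sum_le_cost G hπ' hc' _ _ (hsupp x) (hsupp y)
    (fun u => S.indicator 1 u + A.indicator 1 u) ?_
  · rw [sum_mul_idleMeasure hd, sum_mul_idleMeasure hd] at key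
    refine le_trans (le_of_eq ?_) key
    ring
  · intro u _ v hv
    by_cases huv : u = v
    · simp [huv]
    have hd1 : (1 : ℝ) ≤ G.dist u v := by exact_mod_cast one_le_dist hG huv
    -- Distinct points have distance at least `1`, so only a drop from `2` to `0` needs `hA`.
    have hv' : v = y ∨ G.Adj y v := by simpa using hv
    by_cases hvS : v ∈ S
    · have : (A.indicator 1 v : ℝ) ≥ 0 := Set.indicator_nonneg (by simp) v
      by_cases huA : u ∈ A
      · simp [huA, hAS huA, hvS]; linarith
      · by_cases huS : u ∈ S <;> simp [huA, huS, hvS] <;> linarith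
    · have hvA : v ∉ A := fun h => hvS (hAS h)
      by_cases huA : u ∈ A
      · have : (2 : ℝ) ≤ G.dist u v := by
          exact_mod_cast two_le_dist hG huv (hA u huA v hv' hvS)
        simp [huA, hAS huA, hvS, hvA]; linarith
      · by_cases huS : u ∈ S
        · simpa [huA, huS, hvS, hvA] using hd1
        · simp [huA, huS, hvS, hvA]

end IdleMeasure

/-! ### Upper bounds for the curvature -/

section Bounds

variable {G : SimpleGraph V} [G.LocallyFinite] {d : ℕ}

lemma sum_indicator_one (s : Finset V) (S : Set V) [DecidablePred (· ∈ S)] :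
    ∑ u ∈ s, (S.indicator 1 u : ℝ) = (s.filter (· ∈ S)).card := by
  simp [Set.indicator_apply]

/-- Without triangles at `x` the two neighbourhoods are disjoint, so all mass moves by at least `1`.
-/
lemma kappa_zero_le_zero (hG : G.Connected) (hd : G.IsRegularOfDegree d) {x y : V}
    (hx : ¬ InTriangle G x) (hxy : G.Adj x y) (hd0 : (d : ℝ) ≠ 0) : kappa G 0 x y ≤ 0 := by
  classical
  have h := le_wasserstein hG hd le_rfl zero_le_one x y (G.neighborSet x) ∅ (by simp) (by simp)
  have e1 : ∑ u ∈ G.neighborFinset x, ((G.neighborSet x).indicator 1 u : ℝ) = d := by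
    rw [Finset.sum_congr rfl (g := fun _ => (1 : ℝ)) fun u hu => by
      simp only [SimpleGraph.mem_neighborFinset] at hu; simp [hu]]
    simp [hd x]
  have e2 : ∑ u ∈ G.neighborFinset y, ((G.neighborSet x).indicator 1 u : ℝ) = 0 := by
    refine Finset.sum_eq_zero fun u hu => ?_
    have hu' : G.Adj y u := by simpa using hu
    have : ¬ G.Adj x u := fun h => not_adj_of_adj hx hxy h hu'
    simp [this]
  simp only [Set.indicator_empty, add_zero] at h
  rw [e1, e2] at h
  unfold kappa
  have : (1 - 0) / (d : ℝ) * (d - 0) = 1 := by field_simp; ring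
  linarith

/-- The potential is `1` on `B_1(x)`, raised to `2` at `a` and `b`. As `x` is the only neighbour of
`y` in `B_1(x)`, the transport costs at least `(d + 2 - 1) / d`. -/
lemma kappa_zero_neg (hG : G.Connected) (hd : G.IsRegularOfDegree d) {x y a b : V}
    (hx : ¬ InTriangle G x) (hxy : G.Adj x y) (hd0 : (0 : ℝ) < d) (ha : G.Adj x a)
    (hb : G.Adj x b) (hab : a ≠ b)
    (ha' : ∀ z, z ≠ x → G.Adj y z → ¬ G.Adj a z) (hb' : ∀ z, z ≠ x → G.Adj y z → ¬ G.Adj b z) :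
    kappa G 0 x y < 0 := by
  classical
  have h := le_wasserstein hG hd le_rfl zero_le_one x y (insert x (G.neighborSet x)) {a, b}
    (by rintro u (rfl | rfl) <;> simp [ha, hb])
    (by
      intro u hu v hv hvS
      simp only [Set.mem_insert_iff, SimpleGraph.mem_neighborSet, not_or] at hvS
      rcases hv with rfl | hv
      · exact absurd hxy hvS.2
      · rcases hu with rfl | rfl
        · exact ha' v hvS.1 hv
        · exact hb' v hvS.1 hv)
  have e1 : ∑ u ∈ G.neighborFinset x, ((insert x (G.neighborSet x)).indicator 1 u : ℝ) = d := by
    rw [Finset.sum_congr rfl (g := fun _ => (1 : ℝ)) fun u hu => by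
      simp only [SimpleGraph.mem_neighborFinset] at hu; simp [hu]]
    simp [hd x]
  have e2 : ∑ u ∈ G.neighborFinset x, (({a, b} : Set V).indicator 1 u : ℝ) = 2 := by
    rw [sum_indicator_one]
    have : (G.neighborFinset x).filter (· ∈ ({a, b} : Set V)) = {a, b} := by
      ext u
      simp only [Finset.mem_filter, SimpleGraph.mem_neighborFinset, Set.mem_insert_iff,
        Set.mem_singleton_iff, Finset.mem_insert, Finset.mem_singleton]
      exact ⟨fun h => h.2, fun h => ⟨by rcases h with rfl | rfl <;> assumption, h⟩⟩
    rw [this, Finset.card_pair hab]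
    norm_num
  have e3 : ∑ u ∈ G.neighborFinset y, ((insert x (G.neighborSet x)).indicator 1 u : ℝ) = 1 := by
    rw [Finset.sum_eq_single x]
    · simp
    · intro u hu hux
      have hu' : G.Adj y u := by simpa using hu
      have : ¬ G.Adj x u := fun h => not_adj_of_adj hx hxy h hu'
      simp [this, hux]
    · intro h
      exact absurd hxy.symm (by simpa using h)
  have e4 : ∑ u ∈ G.neighborFinset y, (({a, b} : Set V).indicator 1 u : ℝ) = 0 := by
    refine Finset.sum_eq_zero fun u hu => ?_
    have hu' : G.Adj y u := by simpa using hu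
    have h1 : u ≠ a := by rintro rfl; exact not_adj_of_adj hx hxy ha hu'
    have h2 : u ≠ b := by rintro rfl; exact not_adj_of_adj hx hxy hb hu'
    simp [h1, h2]
  rw [Finset.sum_add_distrib, Finset.sum_add_distrib, e1, e2, e3, e4] at h
  unfold kappa
  have : (1 - 0) / (d : ℝ) * (d + 2 - (1 + 0)) = 1 + 1 / d := by field_simp; ring
  have : 0 < 1 / (d : ℝ) := by positivity
  linarith

lemma sum_indicator_ball_diff_self (hd : G.IsRegularOfDegree d) {x y : V} (hxy : G.Adj x y) :
    ∑ u ∈ G.neighborFinset x, ((insert x (G.neighborSet x) \ {y}).indicator 1 u : ℝ)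
      = d - 1 := by
  classical
  rw [← Finset.add_sum_erase _ _ (by simpa using hxy : y ∈ G.neighborFinset x),
    Finset.sum_congr rfl (g := fun _ => (1 : ℝ)) fun u hu => by
      simp only [Finset.mem_erase, SimpleGraph.mem_neighborFinset] at hu
      simp [hu]]
  have hpos : 1 ≤ d := by
    rw [← hd x]
    exact (G.degree_pos_iff_exists_adj x).2 ⟨y, hxy⟩
  simp [Finset.card_erase_of_mem, hxy, hd x, Nat.cast_sub hpos]

lemma sum_indicator_ball_diff_neighbor {x y : V} (hx : ¬ InTriangle G x) (hxy : G.Adj x y) :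
    ∑ u ∈ G.neighborFinset y, ((insert x (G.neighborSet x) \ {y}).indicator 1 u : ℝ) = 1 := by
  classical
  rw [Finset.sum_eq_single x]
  · simp [hxy.ne]
  · intro u hu hux
    have hu' : G.Adj y u := by simpa using hu
    have : ¬ G.Adj x u := fun h => not_adj_of_adj hx hxy h hu'
    simp [this, hux]
  · intro h
    exact absurd hxy.symm (by simpa using h)

/-- The indicator of `B_1(x) \ {y}` is a potential that forces cost `p + (d - 2)(1 - p)/d`. -/
lemma kappa_le (hG : G.Connected) (hd : G.IsRegularOfDegree d) {x y : V}
    (hx : ¬ InTriangle G x) (hxy : G.Adj x y) (hd0 : (d : ℝ) ≠ 0) {p : ℝ} (h0 : 0 ≤ p)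
    (h1 : p ≤ 1) : kappa G p x y ≤ 2 * ((1 - p) / d) := by
  classical
  have h := le_wasserstein hG hd h0 h1 x y (insert x (G.neighborSet x) \ {y}) ∅ (by simp)
    (by simp)
  simp only [Set.indicator_empty, add_zero] at h
  rw [sum_indicator_ball_diff_self hd hxy, sum_indicator_ball_diff_neighbor hx hxy] at h
  have e1 : ((insert x (G.neighborSet x) \ {y}).indicator 1 x : ℝ) = 1 := by simp [hxy.ne]
  have e2 : ((insert x (G.neighborSet x) \ {y}).indicator 1 y : ℝ) = 0 := by simp
  rw [e1, e2] at h
  unfold kappa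
  have : (1 - p) / (d : ℝ) * (d - 1 - 1) = (1 - p) - 2 * ((1 - p) / d) := by field_simp; ring
  linarith

/-- Raising the potential of `kappa_le` to `2` at `a` gains a further `(1 - p)/d`. -/
lemma kappa_le_of_no_common_neighbor (hG : G.Connected) (hd : G.IsRegularOfDegree d)
    {x y a : V} (hx : ¬ InTriangle G x) (hxy : G.Adj x y) (hd0 : (d : ℝ) ≠ 0)
    (ha : G.Adj x a) (hay : a ≠ y) (ha' : ∀ z, z ≠ x → G.Adj y z → ¬ G.Adj a z) {p : ℝ}
    (h0 : 0 ≤ p) (h1 : p ≤ 1) : kappa G p x y ≤ (1 - p) / d := by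
  classical
  have h := le_wasserstein hG hd h0 h1 x y (insert x (G.neighborSet x) \ {y}) {a}
    (by rintro u rfl; simp [ha, hay])
    (by
      rintro u rfl v hv hvS
      rcases hv with rfl | hv
      · exact not_adj_of_adj hx ha hxy
      · refine ha' v ?_ hv
        rintro rfl
        exact hvS (by simp [hxy.ne]))
  have e1 : ((insert x (G.neighborSet x) \ {y}).indicator 1 x : ℝ) = 1 := by simp [hxy.ne]
  have e2 : ((insert x (G.neighborSet x) \ {y}).indicator 1 y : ℝ) = 0 := by simp
  have e3 : (({a} : Set V).indicator 1 x : ℝ) = 0 := by simp [ha.ne]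
  have e4 : (({a} : Set V).indicator 1 y : ℝ) = 0 := by simp [hay.symm]
  have e5 : ∑ u ∈ G.neighborFinset x, (({a} : Set V).indicator 1 u : ℝ) = 1 := by
    simp [Set.indicator_apply, ha]
  have e6 : ∑ u ∈ G.neighborFinset y, (({a} : Set V).indicator 1 u : ℝ) = 0 := by
    simp [Set.indicator_apply, not_adj_of_adj hx hxy ha]
  rw [Finset.sum_add_distrib, Finset.sum_add_distrib, sum_indicator_ball_diff_self hd hxy,
    sum_indicator_ball_diff_neighbor hx hxy, e1, e2, e3, e4, e5, e6] at h
  unfold kappa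
  have : (1 - p) / (d : ℝ) * (d - 1 + 1 - (1 + 0)) = (1 - p) - (1 - p) / d := by
    field_simp; ring
  linarith

end Bounds

/-! ### Common neighbours and Ricci flat families -/

section Flatness

variable {G : SimpleGraph V} {d : ℕ}

/-- The common neighbours of `u` and `v` other than `x`. -/
def commonNeighborsNe (G : SimpleGraph V) (x u v : V) : Set V :=
  {z | z ≠ x ∧ G.Adj u z ∧ G.Adj v z}

lemma commonNeighborsNe_comm (G : SimpleGraph V) (x u v : V) :
    commonNeighborsNe G x u v = commonNeighborsNe G x v u := by
  ext z
  simp only [commonNeighborsNe, Set.mem_ofPred_eq]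
  tauto

open Classical in
/-- A common neighbour of `u` and `v`, chosen symmetrically and different from `x` if
possible. -/
noncomputable def commonNeighbor (G : SimpleGraph V) (x u v : V) : V :=
  if h : (commonNeighborsNe G x u v).Nonempty then h.some else x

lemma commonNeighbor_comm (G : SimpleGraph V) (x u v : V) :
    commonNeighbor G x u v = commonNeighbor G x v u := by
  unfold commonNeighbor
  rw [commonNeighborsNe_comm G x u v]

lemma commonNeighbor_mem {x u v : V} (h : (commonNeighborsNe G x u v).Nonempty) :
    commonNeighbor G x u v ∈ commonNeighborsNe G x u v := by
  unfold commonNeighbor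
  rw [dif_pos h]
  exact h.some_mem

lemma adj_commonNeighbor {x u : V} (hu : G.Adj x u) (v : V) :
    G.Adj u (commonNeighbor G x u v) := by
  by_cases h : (commonNeighborsNe G x u v).Nonempty
  · exact (commonNeighbor_mem h).2.1
  · unfold commonNeighbor
    rw [dif_neg h]
    exact hu.symm

variable [G.LocallyFinite]

lemma not_three_neighbors {x : V} (hG : G.Connected) (hx : ¬ InTriangle G x)
    (hin : ∀ z ∈ sphere G 2 x, inDegree G x z ≤ 2) {z a b c : V} (hzx : z ≠ x)
    (ha : G.Adj x a) (hb : G.Adj x b) (hc : G.Adj x c) (hab : a ≠ b) (hac : a ≠ c)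
    (hbc : b ≠ c) (hza : G.Adj a z) (hzb : G.Adj b z) (hzc : G.Adj c z) : False := by
  have h2 : G.dist x z = 2 := by
    refine le_antisymm ?_ (two_le_dist hG hzx.symm fun h => not_adj_of_adj hx ha h hza)
    have := hG.dist_triangle (u := x) (v := a) (w := z)
    rwa [SimpleGraph.dist_eq_one_iff_adj.2 ha, SimpleGraph.dist_eq_one_iff_adj.2 hza] at this
  have hle := hin z h2
  -- Finiteness matters: `Set.ncard` is `0` on infinite sets.
  have hfin : {y | G.Adj z y ∧ G.dist x y + 1 = G.dist x z}.Finite :=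
    (Set.toFinite (G.neighborSet z)).subset fun y hy => hy.1
  have hsub : ({a, b, c} : Set V) ⊆ {y | G.Adj z y ∧ G.dist x y + 1 = G.dist x z} := by
    rintro u (rfl | rfl | rfl) <;>
      refine ⟨by apply SimpleGraph.Adj.symm; assumption, ?_⟩ <;>
      rw [h2, SimpleGraph.dist_eq_one_iff_adj.2 (by assumption)]
  have h3 := Set.ncard_le_ncard hsub hfin
  rw [Set.ncard_eq_three.2 ⟨a, b, c, hab, hac, hbc, rfl⟩] at h3
  unfold inDegree at hle
  omega

/-- A coincidence away from `x` would have the three neighbours `u`, `v`, `v'` in `S_1(x)`; `hne`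
rules out that both values are the default `x`. -/
lemma commonNeighbor_injective {x u v v' : V} (hG : G.Connected) (hx : ¬ InTriangle G x)
    (hin : ∀ z ∈ sphere G 2 x, inDegree G x z ≤ 2) (hu : G.Adj x u) (hv : G.Adj x v)
    (hv' : G.Adj x v') (huv : v ≠ u) (huv' : v' ≠ u) (hvv' : v ≠ v')
    (hne : (commonNeighborsNe G x u v).Nonempty ∨ (commonNeighborsNe G x u v').Nonempty) :
    commonNeighbor G x u v ≠ commonNeighbor G x u v' := by
  intro heq
  by_cases h : (commonNeighborsNe G x u v).Nonempty
  · have hm := commonNeighbor_mem h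
    by_cases h' : (commonNeighborsNe G x u v').Nonempty
    · have hm' := commonNeighbor_mem h'
      rw [← heq] at hm'
      exact not_three_neighbors hG hx hin hm.1 hu hv hv' huv.symm huv'.symm hvv' hm.2.1 hm.2.2
        hm'.2.2
    · refine hm.1 (heq.trans ?_)
      unfold commonNeighbor
      rw [dif_neg h']
  · have hm' := commonNeighbor_mem (hne.resolve_left h)
    refine hm'.1 (heq.symm.trans ?_)
    unfold commonNeighbor
    rw [dif_neg h]

/-- Ricci flatness from a choice `m u` of a neighbour of `u` which is not one of the chosen common
neighbours of `u` and the other neighbours of `x`. -/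
lemma exists_symmetric_family {x : V} (hG : G.Connected) (hd : G.IsRegularOfDegree d)
    (hx : ¬ InTriangle G x) (hin : ∀ z ∈ sphere G 2 x, inDegree G x z ≤ 2)
    (hne : ∀ u v v', G.Adj x u → G.Adj x v → G.Adj x v' → v ≠ u → v' ≠ u → v ≠ v' →
      (commonNeighborsNe G x u v).Nonempty ∨ (commonNeighborsNe G x u v').Nonempty)
    (m : V → V) (hm : ∀ u, G.Adj x u → G.Adj u (m u))
    (hm' : ∀ u v, G.Adj x u → G.Adj x v → v ≠ u → commonNeighbor G x u v ≠ m u) :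
    ∃ η : Fin d → V → V, IsRicciFlatFamily G d x η ∧ FamilySymmetric x η ∧
      ∀ i, G.Adj x (η i x) ∧ η i (η i x) = m (η i x) := by
  classical
  obtain ⟨e, he, hadj⟩ := exists_enumeration hd x
  let η : Fin d → V → V := fun j u =>
    if u = x then e j else if u = e j then m u else commonNeighbor G x u (e j)
  have hηx : ∀ j, η j x = e j := fun j => if_pos rfl
  have hηd : ∀ j, η j (e j) = m (e j) := fun j => by
    simp only [η]
    rw [if_neg (hadj j).ne', if_pos trivial]
  have hηn : ∀ i j, i ≠ j → η j (e i) = commonNeighbor G x (e i) (e j) := fun i j hij => by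
    simp only [η]
    rw [if_neg (hadj i).ne', if_neg (he.ne hij)]
  have hsymm : FamilySymmetric x η := by
    intro i j
    rw [hηx, hηx]
    by_cases hij : i = j
    · rw [hij]
    · rw [hηn i j hij, hηn j i (Ne.symm hij), commonNeighbor_comm]
  refine ⟨η, ⟨?_, ?_, ?_⟩, hsymm, fun i => ?_⟩
  · intro j u hu
    rcases (mem_ball_one_iff hG).1 hu with rfl | hu
    · rw [hηx]
      exact (hadj j).symm
    · obtain ⟨i, rfl⟩ := exists_eq_of_adj hd he hadj hu
      by_cases hij : i = j
      · subst hij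
        rw [hηd]
        exact (hm _ hu).symm
      · rw [hηn i j hij]
        exact (adj_commonNeighbor hu _).symm
  · intro j k hjk u hu
    rcases (mem_ball_one_iff hG).1 hu with rfl | hu
    · rw [hηx, hηx]
      exact he.ne hjk
    · obtain ⟨i, rfl⟩ := exists_eq_of_adj hd he hadj hu
      by_cases hij : i = j
      · subst hij
        rw [hηd, hηn i k hjk]
        exact (hm' _ _ hu (hadj k) (he.ne hjk.symm)).symm
      · rw [hηn i j hij]
        by_cases hik : i = k
        · subst hik
          rw [hηd]
          exact hm' _ _ hu (hadj j) (he.ne hjk)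
        · rw [hηn i k hik]
          exact commonNeighbor_injective hG hx hin hu (hadj j) (hadj k) (he.ne (Ne.symm hij))
            (he.ne (Ne.symm hik)) (he.ne hjk) (hne _ _ _ hu (hadj j) (hadj k)
            (he.ne (Ne.symm hij)) (he.ne (Ne.symm hik)) (he.ne hjk))
  -- Condition (iii) holds term by term because of (S).
  · intro i
    exact Set.iUnion_congr fun j => by rw [hsymm i j]
  · rw [hηx]
    exact ⟨hadj i, hηd i⟩

/-- Only `d - 1` vertices `v` compete for the `d` neighbours of `u`. -/
lemma exists_missing_neighbor (hd : G.IsRegularOfDegree d) {x u : V} (hu : G.Adj x u)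
    (c : V → V) : ∃ z, G.Adj u z ∧ ∀ v, G.Adj x v → v ≠ u → c v ≠ z := by
  classical
  have hlt : (((G.neighborFinset x).erase u).image c).card < (G.neighborFinset u).card := by
    refine Finset.card_image_le.trans_lt ?_
    rw [G.card_neighborFinset_eq_degree u, hd u, ← hd x, ← G.card_neighborFinset_eq_degree x]
    exact Finset.card_erase_lt_of_mem (by simpa using hu)
  obtain ⟨z, hz, hz'⟩ := Finset.exists_mem_notMem_of_card_lt_card hlt
  refine ⟨z, by simpa using hz, fun v hv hvu hcv => hz' ?_⟩
  exact Finset.mem_image.2 ⟨v, by simp [hv, hvu], hcv⟩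

lemma isSRicciFlat_of_commonNeighbors {x : V} (hG : G.Connected) (hd : G.IsRegularOfDegree d)
    (hx : ¬ InTriangle G x) (hin : ∀ z ∈ sphere G 2 x, inDegree G x z ≤ 2)
    (hne : ∀ u v v', G.Adj x u → G.Adj x v → G.Adj x v' → v ≠ u → v' ≠ u → v ≠ v' →
      (commonNeighborsNe G x u v).Nonempty ∨ (commonNeighborsNe G x u v').Nonempty) :
    IsSRicciFlat G d x := by
  have : ∀ u, ∃ z, G.Adj x u → G.Adj u z ∧
      ∀ v, G.Adj x v → v ≠ u → commonNeighbor G x u v ≠ z := by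
    intro u
    by_cases hu : G.Adj x u
    · obtain ⟨z, hz⟩ := exists_missing_neighbor hd hu (commonNeighbor G x u)
      exact ⟨z, fun _ => hz⟩
    · exact ⟨u, fun h => absurd h hu⟩
  choose m hm using this
  obtain ⟨η, hη, hS, -⟩ := exists_symmetric_family hG hd hx hin hne m (fun u hu => (hm u hu).1)
    fun u v hu hv hvu => (hm u hu).2 v hv hvu
  exact ⟨η, hη, hS⟩

lemma isRSRicciFlat_of_commonNeighbors {x : V} (hG : G.Connected)
    (hd : G.IsRegularOfDegree d) (hx : ¬ InTriangle G x)
    (hin : ∀ z ∈ sphere G 2 x, inDegree G x z ≤ 2)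
    (hne : ∀ u v, G.Adj x u → G.Adj x v → v ≠ u → (commonNeighborsNe G x u v).Nonempty) :
    IsRSRicciFlat G d x := by
  obtain ⟨η, hη, hS, hR⟩ := exists_symmetric_family hG hd hx hin
    (fun u v _ hu hv _ hvu _ _ => Or.inl (hne u v hu hv hvu)) (fun _ => x)
    (fun u hu => hu.symm)
    fun u v hu hv hvu => (commonNeighbor_mem (hne u v hu hv hvu)).1
  exact ⟨η, hη, fun i => (hR i).2, hS⟩

/-- A symmetric family matches the neighbourhoods of `x` and `y`. -/
lemma IsRicciFlatFamily.exists_matching {x y : V} (hG : G.Connected)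
    (hd : G.IsRegularOfDegree d) {η : Fin d → V → V} (hη : IsRicciFlatFamily G d x η)
    (hS : FamilySymmetric x η) (hxy : G.Adj x y) :
    Function.Injective (fun i => η i x) ∧ (∀ i, G.Adj x (η i x)) ∧
      Function.Injective (fun i => η i y) ∧ (∀ i, G.Adj y (η i y)) ∧
      (∀ i, G.Adj (η i x) (η i y)) ∧ ∃ k, η k x = y := by
  have hxb : x ∈ ball G 1 x := (mem_ball_one_iff hG).2 (Or.inl rfl)
  have hyb : y ∈ ball G 1 x := (mem_ball_one_iff hG).2 (Or.inr hxy)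
  have hadj : ∀ i, G.Adj x (η i x) := fun i => (hη.adj i x hxb).symm
  obtain ⟨k, hk⟩ := exists_eq_of_adj hd (hη.injective hxb) hadj hxy
  refine ⟨hη.injective hxb, hadj, hη.injective hyb, fun i => (hη.adj i y hyb).symm, fun i => ?_,
    k, hk.symm⟩
  -- With `y = η k x`, (S) gives `η i y = η k (η i x)`, a neighbour of `η i x`.
  have hib : η i x ∈ ball G 1 x := (mem_ball_one_iff hG).2 (Or.inr (hadj i))
  have := (hη.adj k _ hib).symm
  rwa [hS i k, ← hk] at this

end Flatness

end RicciCurvature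

/-! ### The two equivalences -/

open RicciCurvature in
theorem theorem4p3 {V : Type*} (G : SimpleGraph V) [G.LocallyFinite] (hG : G.Connected)
    (d : ℕ) (hd : G.IsRegularOfDegree d) (x : V)
    (hx : ¬ RicciCurvature.InTriangle G x)
    (hin : ∀ z ∈ RicciCurvature.sphere G 2 x, RicciCurvature.inDegree G x z ≤ 2) :
    ((∀ y ∈ RicciCurvature.sphere G 1 x, RicciCurvature.kappa G 0 x y = 0) ↔
      RicciCurvature.IsSRicciFlat G d x) ∧
    ((∀ y ∈ RicciCurvature.sphere G 1 x,
        RicciCurvature.KappaLLYEq G x y (2 / (d : ℝ))) ↔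
      RicciCurvature.IsRSRicciFlat G d x) := by
  have hpos : ∀ y, G.Adj x y → (1 : ℝ) ≤ d := by
    intro y hxy
    rw [← hd x]
    exact_mod_cast (G.degree_pos_iff_exists_adj x).2 ⟨y, hxy⟩
  simp only [mem_sphere_one_iff]
  refine ⟨⟨fun h => ?_, ?_⟩, ⟨fun h => ?_, ?_⟩⟩
  · refine isSRicciFlat_of_commonNeighbors hG hd hx hin ?_
    intro u v v' hu hv hv' _ _ hvv'
    by_contra! hcon
    refine (kappa_zero_neg hG hd hx hu (by linarith [hpos u hu]) hv hv' hvv' ?_ ?_).ne (h u hu)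
    · intro z hzx hz hvz
      exact Set.eq_empty_iff_forall_notMem.1 hcon.1 z ⟨hzx, hz, hvz⟩
    · intro z hzx hz hvz
      exact Set.eq_empty_iff_forall_notMem.1 hcon.2 z ⟨hzx, hz, hvz⟩
  · rintro ⟨η, hη, hS⟩ y hxy
    have hd0 : (d : ℝ) ≠ 0 := by linarith [hpos y hxy]
    refine le_antisymm (kappa_zero_le_zero hG hd hx hxy hd0) ?_
    obtain ⟨he, hadj, he', hadj', hedge, -⟩ := hη.exists_matching hG hd hS hxy
    obtain ⟨π, hπ, hc⟩ := exists_plan_matching hd le_rfl zero_le_one he hadj he' hadj'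
    have hW := wasserstein_le hπ hc
    simp only [SimpleGraph.dist_eq_one_iff_adj.2 (hedge _)] at hW
    have : (G.dist x y : ℝ) * 0 + ∑ _i : Fin d, ((1 : ℕ) : ℝ) * ((1 - 0) / (d : ℝ)) = 1 := by
      simp [hd0]
    unfold kappa
    linarith
  · refine isRSRicciFlat_of_commonNeighbors hG hd hx hin ?_
    intro u v hu hv hvu
    by_contra hcon
    have hd1 := hpos u hu
    have hev : ∀ᶠ p : ℝ in 𝓝[<] 1, kappa G p x u / (1 - p) ≤ 1 / d := by
      filter_upwards [Ioo_mem_nhdsLT (zero_lt_one' ℝ)] with p hp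
      have := kappa_le_of_no_common_neighbor hG hd hx hu (by linarith) hv hvu
        (fun z hzx hz hvz => hcon ⟨z, hzx, hz, hvz⟩) hp.1.le hp.2.le
      rw [div_le_iff₀ (by linarith [hp.2])]
      calc _ ≤ _ := this
        _ = _ := by ring
    have := le_of_tendsto (h u hu) hev
    rw [div_le_div_iff_of_pos_right (by linarith)] at this
    norm_num at this
  · rintro ⟨η, hη, hR, hS⟩ y hxy
    have hd1 := hpos y hxy
    obtain ⟨he, hadj, he', hadj', hedge, k, hk⟩ := hη.exists_matching hG hd hS hxy
    have hk' : η k y = x := by rw [← hk]; exact hR k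
    refine Tendsto.congr' ?_ tendsto_const_nhds
    -- For `p > 1/2` and `d ≥ 1` the mass at `x` is at least `(1 - p)/d`, as the swap requires.
    filter_upwards [Ioo_mem_nhdsLT (by norm_num : (1 / 2 : ℝ) < 1)] with p hp
    obtain ⟨hp0, hp1⟩ := hp
    have hp' : (1 - p) / (d : ℝ) ≤ p := by
      rw [div_le_iff₀ (by linarith)]
      nlinarith
    obtain ⟨π, hπ, hc⟩ := exists_plan_of_swap hd hp1.le hp' he hadj he' hadj' hk hk' hedge
    have hW := wasserstein_le hπ hc
    have hle := kappa_le hG hd hx hxy (by linarith) (by linarith : 0 ≤ p) hp1.le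
    have hκ : kappa G p x y = 2 * ((1 - p) / d) := by
      refine le_antisymm hle ?_
      unfold kappa
      linarith
    rw [hκ]
    have : 1 - p ≠ 0 := by linarith
    field_simp
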